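/- Theorem. All alphabets are finite. A labeled graph has finite sets of vertices and edges (loops and parallel edges allowed) and a label on each edge; it is deterministic if no two distinct edges with the same source have the same label, and essential if every vertex has an outgoing and an incoming edge. The sofic shift presented by a labeled graph is the set of label sequences of its bi-infinite paths. A deterministic presentation of $X$ is an essential deterministic labeled graph presenting $X$; it is synchronizing if for every vertex $r$ there is a word $w$ that labels at least one path and such that every path labeled $w$ ends in $r$. A minimal (synchronizing) deterministic presentation of $X$ is one with the fewest vertices among all (synchronizing) deterministic presentations of $X$. There are a family of sofic shifts $(X_n)_{n \ge 0}$ over one common finite alphabet, a constant $c>0$ and an $n_0$ such that for all $n \ge n_0$ a minimal deterministic presentation of $X_n$ has at most $n$ vertices, and a minimal synchronizing deterministic presentation of $X_n$ exists and has at least $2^{cn}$ vertices (that is, $2^{\Omega(n)}$ vertices). Moreover, the $X_n$ can be chosen as follows. A $k$-entry DFA is a complete deterministic finite automaton with $k$ distinct initial states $s_1,\dots,s_k$ instead of one, and its language is the set of words accepted from at least one of them. There are a finite alphabet $\Sigma$ and $k$-entry DFAs $C_k$ over $\Sigma$ ($k \ge 0$) such that $C_k$ has $k$ states and, for $k\ge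 1$, the minimal DFA of $L(C_k)$ has exactly $2^k-1$ states. Let $G_k$ be the labeled graph obtained from the transition graph of $C_k$ by adding vertices $p_1,\dots,p_k$ and $t$, a loop labeled $*$ at each $p_i$, an edge labeled $\triangleleft$ from $p_i$ to $s_i$ for each $i$, an edge labeled $\triangleright$ from each accepting state to $t$, and a loop labeled $\star$ at $t$, where $*,\triangleleft,\triangleright,\star$ are four new symbols. Then for all $n\ge n_0$ the graph $G_{\lfloor (n-1)/2\rfloor}$ is a deterministic presentation of $X_n$ with at most $n$ vertices. -/

import Mathlib

/-- A labeled graph over the alphabet `A`: a finite directed multigraph (loops and parallel edges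
allowed) whose edges carry labels in `A`. -/
structure LabeledGraph (A : Type) where
  V : Type
  E : Type
  finite_V : Finite V
  finite_E : Finite E
  source : E → V
  target : E → V
  label : E → A

namespace LabeledGraph

variable {A : Type}

/-- `G.Path p w q`: there is a (possibly empty) path in `G` from `p` to `q` with label `w`. -/
inductive Path (G : LabeledGraph A) : G.V → List A → G.V → Prop
  | nil (q : G.V) : Path G q [] q
  | cons (e : G.E) {w : List A} {r : G.V} (h : Path G (G.target e) w r) :
      Path G (G.source e) (G.label e :: w) r

/-- The set of label sequences of bi-infinite paths in `G`. -/
def shift (G : LabeledGraph A) : Set (ℤ → A) :=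
  {y | ∃ x : ℤ → G.E, (∀ i, G.target (x i) = G.source (x (i + 1))) ∧ ∀ i, y i = G.label (x i)}

/-- No vertex is stranded: every vertex has an outgoing edge and an incoming edge. -/
def Essential (G : LabeledGraph A) : Prop :=
  ∀ q : G.V, (∃ e, G.source e = q) ∧ (∃ e, G.target e = q)

def Deterministic (G : LabeledGraph A) : Prop :=
  ∀ e f : G.E, G.source e = G.source f → G.label e = G.label f → e = f

/-- The action of the word `w` on the set `S` of vertices. -/
def act (G : LabeledGraph A) (S : Set G.V) (w : List A) : Set G.V :=
  {r | ∃ q ∈ S, G.Path q w r}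

/-- The word `w` synchronizes to the vertex `r`: some vertex admits a path labeled `w`, and all
paths labeled `w` end in `r`. -/
def SynchronizesTo (G : LabeledGraph A) (w : List A) (r : G.V) : Prop :=
  G.act Set.univ w = {r}

/-- Every vertex is synchronized to by some word. -/
def Synchronizing (G : LabeledGraph A) : Prop :=
  ∀ r : G.V, ∃ w : List A, G.SynchronizesTo w r

/-- The number of vertices. -/
noncomputable def numVertices (G : LabeledGraph A) : ℕ := Nat.card G.V

/-- `G` is a deterministic presentation of `X`; presentations are essential. -/
def IsDetPresentation (G : LabeledGraph A) (X : Set (ℤ → A)) : Prop :=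
  G.Essential ∧ G.Deterministic ∧ G.shift = X

/-- `G` is a synchronizing deterministic presentation of `X`. -/
def IsSDP (G : LabeledGraph A) (X : Set (ℤ → A)) : Prop :=
  G.IsDetPresentation X ∧ G.Synchronizing

/-- `G` is a deterministic presentation of `X` with the fewest vertices. -/
def IsMinimalDetPresentation (G : LabeledGraph A) (X : Set (ℤ → A)) : Prop :=
  G.IsDetPresentation X ∧
    ∀ H : LabeledGraph A, H.IsDetPresentation X → G.numVertices ≤ H.numVertices

/-- `G` is a synchronizing deterministic presentation of `X` with the fewest vertices. -/
def IsMinimalSDP (G : LabeledGraph A) (X : Set (ℤ → A)) : Prop :=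
  G.IsSDP X ∧ ∀ H : LabeledGraph A, H.IsSDP X → G.numVertices ≤ H.numVertices

end LabeledGraph

/-- A sofic shift over `A` is a set of bi-infinite sequences presented by a labeled graph. -/
def IsSofic {A : Type} (X : Set (ℤ → A)) : Prop :=
  ∃ G : LabeledGraph A, G.shift = X

/-- A `k`-entry DFA over the alphabet `S`: a complete deterministic transition function on finitely
many states, with `k` distinct initial states and a set of accepting states. -/
structure MultiEntryDFA (S : Type) (k : ℕ) where
  Q : Type
  finite_Q : Finite Q
  step : Q → S → Q
  entry : Fin k → Q
  entry_injective : Function.Injective entry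
  accept : Set Q

/-- The labels of the graph built from a multiple-entry DFA over `S`: the letters of `S` and four
new symbols (loops at the pre-initial states, left marker, right marker, loop at the terminal
state). -/
inductive Symb (S : Type) : Type
  | letter (a : S)
  | preLoop
  | leftMark
  | rightMark
  | termLoop

namespace MultiEntryDFA

variable {S : Type} {k : ℕ}

/-- The union, over all initial states, of the languages of the resulting ordinary DFAs. -/
def language (N : MultiEntryDFA S k) : Language S :=
  {w | ∃ i : Fin k, w ∈ (DFA.mk N.step (N.entry i) N.accept).accepts}

/-- The vertices of the graph built from `N`: the states of `N`, the pre-initial states `p_i`, and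
the terminal state `t`. -/
inductive Vertex (N : MultiEntryDFA S k) : Type
  | state (q : N.Q)
  | pre (i : Fin k)
  | term

/-- The edges of the graph built from `N`: the transitions of `N`; a loop at each pre-initial state;
an edge from the `i`-th pre-initial state to the `i`-th initial state; an edge from each accepting
state to the terminal state; a loop at the terminal state. -/
inductive Edge (N : MultiEntryDFA S k) : Type
  | trans (q : N.Q) (a : S)
  | preLoop (i : Fin k)
  | enter (i : Fin k)
  | exit (q : N.accept)
  | termLoop

theorem finite_vertex (N : MultiEntryDFA S k) : Finite N.Vertex := by
  have := N.finite_Q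
  refine Finite.of_surjective
    (fun x : N.Q ⊕ Fin k ⊕ Unit =>
      x.elim Vertex.state (fun y => y.elim Vertex.pre (fun _ => Vertex.term))) ?_
  rintro (q | i | _)
  · exact ⟨.inl q, rfl⟩
  · exact ⟨.inr (.inl i), rfl⟩
  · exact ⟨.inr (.inr ()), rfl⟩

theorem finite_edge [Finite S] (N : MultiEntryDFA S k) : Finite N.Edge := by
  have := N.finite_Q
  refine Finite.of_surjective
    (fun x : (N.Q × S) ⊕ Fin k ⊕ Fin k ⊕ N.accept ⊕ Unit =>
      x.elim (fun z => Edge.trans z.1 z.2) (fun y => y.elim Edge.preLoop (fun y => y.elim Edge.enter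
        (fun y => y.elim Edge.exit (fun _ => Edge.termLoop))))) ?_
  rintro (⟨q, a⟩ | i | i | q | _)
  · exact ⟨.inl (q, a), rfl⟩
  · exact ⟨.inr (.inl i), rfl⟩
  · exact ⟨.inr (.inr (.inl i)), rfl⟩
  · exact ⟨.inr (.inr (.inr (.inl q))), rfl⟩
  · exact ⟨.inr (.inr (.inr (.inr ()))), rfl⟩

/-- The labeled graph obtained from `N` by adding pre-initial states and a terminal state. -/
def toGraph [Finite S] (N : MultiEntryDFA S k) : LabeledGraph (Symb S) where
  V := N.Vertex
  E := N.Edge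
  finite_V := N.finite_vertex
  finite_E := N.finite_edge
  source
    | .trans q _ => .state q
    | .preLoop i => .pre i
    | .enter i => .pre i
    | .exit q => .state q
    | .termLoop => .term
  target
    | .trans q a => .state (N.step q a)
    | .preLoop i => .pre i
    | .enter i => .state (N.entry i)
    | .exit _ => .term
    | .termLoop => .term
  label
    | .trans _ a => .letter a
    | .preLoop _ => .preLoop
    | .enter _ => .leftMark
    | .exit _ => .rightMark
    | .termLoop => .termLoop

end MultiEntryDFA

/-- The minimal (complete) DFA recognizing `L` has exactly `m` states. -/
def MinimalDFASize {S : Type} (L : Language S) (m : ℕ) : Prop :=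
  IsLeast {j : ℕ | ∃ (Q : Type) (_ : Finite Q) (M : DFA S Q), M.accepts = L ∧ Nat.card Q = j} m

/-! ### Paths and determinism in labeled graphs -/

namespace LabeledGraph

variable {A : Type}

/-! Take for `C k` the cyclic automaton `rotateMerge` in which every state is initial, one letter
rotates the states and the other merges `0` into its successor. Reading `u` from all entries at once
leads to the set `Set.range (N.run · u)`, and every nonempty set of states arises in this way.
Rotations also bring any chosen state, and no other, to the unique accepting state, so different
sets have different residual languages. Hence the language has exactly `2 ^ k - 1` residuals;
`Extremal` isolates the properties used, and `Extremal.le_card` is the counting argument.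

The graph of `C k` has only `2 * k + 1` vertices, because separate pre-initial vertices resolve the
choice of entry. A synchronizing presentation cannot do this. If a word `w` synchronizes to the
source `p` of an edge labeled `leftMark`, then the words readable from `p` are exactly those that
may follow `w`, so the target of that edge must account for all entries together. Reading letters
from there and testing acceptance with `rightMark` distinguishes all residuals, whence the bound in
`Extremal.le_numVertices`. Conversely, the graph of the subset automaton, which has one entry, is a
synchronizing presentation.

Shifts are compared through the words that label finite paths: these determine the shift by
compactness, and are determined by it when the graph is essential. -/

theorem path_nil_iff {G : LabeledGraph A} {p r : G.V} : G.Path p [] r ↔ p = r := by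
  constructor
  · intro h
    cases h
    rfl
  · rintro rfl
    exact .nil _

theorem path_cons_iff {G : LabeledGraph A} {p r : G.V} {a : A} {w : List A} :
    G.Path p (a :: w) r ↔ ∃ e, G.source e = p ∧ G.label e = a ∧ G.Path (G.target e) w r := by
  constructor
  · intro h
    cases h with
    | cons e h => exact ⟨e, rfl, rfl, h⟩
  · rintro ⟨e, rfl, rfl, h⟩
    exact .cons e h

theorem path_append_iff {G : LabeledGraph A} {p r : G.V} {v w : List A} :
    G.Path p (v ++ w) r ↔ ∃ q, G.Path p v q ∧ G.Path q w r := by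
  induction v generalizing p with
  | nil => simp [path_nil_iff]
  | cons a v ih =>
    simp only [List.cons_append, path_cons_iff, ih]
    constructor
    · rintro ⟨e, h₁, h₂, q, h₃, h₄⟩
      exact ⟨q, ⟨e, h₁, h₂, h₃⟩, h₄⟩
    · rintro ⟨q, ⟨e, h₁, h₂, h₃⟩, h₄⟩
      exact ⟨e, h₁, h₂, q, h₃, h₄⟩

theorem Deterministic.path_unique {G : LabeledGraph A} (hG : G.Deterministic) {p q r : G.V}
    {w : List A} (hq : G.Path p w q) (hr : G.Path p w r) : q = r := by
  induction w generalizing p with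
  | nil => exact (path_nil_iff.1 hq).symm.trans (path_nil_iff.1 hr)
  | cons a w ih =>
    obtain ⟨e, he, hea, h⟩ := path_cons_iff.1 hq
    obtain ⟨f, hf, hfa, h'⟩ := path_cons_iff.1 hr
    obtain rfl := hG e f (he.trans hf.symm) (hea.trans hfa.symm)
    exact ih h h'

/-! ### Shifts versus words of finite paths -/

/-- The words that label a path of `G`. -/
def words (G : LabeledGraph A) : Set (List A) :=
  {w | ∃ p q, G.Path p w q}

/-- The word `y i, y (i + 1), …, y (i + m - 1)`. -/
def factor (y : ℤ → A) : ℤ → ℕ → List A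
  | _, 0 => []
  | i, m + 1 => y i :: factor y (i + 1) m

theorem path_factor {G : LabeledGraph A} {x : ℤ → G.E}
    (hx : ∀ i, G.target (x i) = G.source (x (i + 1))) (i : ℤ) (m : ℕ) :
    ∃ q, G.Path (G.source (x i)) (factor (fun j => G.label (x j)) i m) q := by
  induction m generalizing i with
  | zero => exact ⟨_, .nil _⟩
  | succ m ih =>
    obtain ⟨q, hq⟩ := ih (i + 1)
    exact ⟨q, .cons _ (hx i ▸ hq)⟩

theorem factor_mem_words {G : LabeledGraph A} {y : ℤ → A} (hy : y ∈ G.shift) (i : ℤ) (m : ℕ) :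
    factor y i m ∈ G.words := by
  obtain ⟨x, hx, hxy⟩ := hy
  obtain rfl : y = fun j => G.label (x j) := funext hxy
  exact ⟨_, path_factor hx i m⟩

/-- A finite path is padded by irrelevant edges outside its window, so that it becomes a point of
the compact space `ℤ → G.E`. -/
theorem exists_edges_of_path {G : LabeledGraph A} [Nonempty G.E] (y : ℤ → A) (m : ℕ) :
    ∀ (i : ℤ) (p q : G.V), G.Path p (factor y i m) q →
      ∃ x : ℤ → G.E, (∀ j, i ≤ j → j < i + m → y j = G.label (x j)) ∧
        (∀ j, i ≤ j → j + 1 < i + m → G.target (x j) = G.source (x (j + 1))) ∧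
        (0 < m → G.source (x i) = p) := by
  induction m with
  | zero =>
    intro i p q _
    refine ⟨fun _ => Classical.arbitrary _, ?_, ?_, ?_⟩
    · intro j h₁ h₂
      simp only [Nat.cast_zero] at h₂
      omega
    · intro j h₁ h₂
      simp only [Nat.cast_zero] at h₂
      omega
    · simp
  | succ m ih =>
    intro i p q h
    obtain ⟨e, he, hea, h⟩ := path_cons_iff.1 h
    obtain ⟨x, hxl, hxs, hx0⟩ := ih (i + 1) _ _ h
    refine ⟨Function.update x i e, ?_, ?_, ?_⟩
    · intro j h₁ h₂
      push_cast at h₂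
      rcases eq_or_ne j i with rfl | hj
      · simp [hea]
      · rw [Function.update_of_ne hj]
        exact hxl j (by omega) (by omega)
    · intro j h₁ h₂
      push_cast at h₂
      rw [Function.update_of_ne (show j + 1 ≠ i by omega)]
      rcases eq_or_ne j i with rfl | hj
      · rw [Function.update_self]
        exact (hx0 (by omega)).symm
      · rw [Function.update_of_ne hj]
        exact hxs j (by omega) (by omega)
    · simp [he]

/-- A sequence all of whose finite factors label paths is the label of a bi-infinite path. -/
theorem mem_shift_of_factor_mem_words {G : LabeledGraph A} {y : ℤ → A}
    (hy : ∀ i m, factor y i m ∈ G.words) : y ∈ G.shift := by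
  have := G.finite_E
  have hE : Nonempty G.E := by
    obtain ⟨p, q, h⟩ := hy 0 1
    obtain ⟨e, -⟩ := path_cons_iff.1 h
    exact ⟨e⟩
  let _ : TopologicalSpace G.E := ⊥
  have : DiscreteTopology G.E := ⟨rfl⟩
  let K : ℕ → Set (ℤ → G.E) := fun n =>
    {x | ∀ j : ℤ, -n ≤ j → j < n → G.target (x j) = G.source (x (j + 1)) ∧ y j = G.label (x j)}
  have hclosed : ∀ n, IsClosed (K n) := by
    intro n
    have : K n = ⋂ (j : ℤ) (_ : -n ≤ j) (_ : j < n), (fun x : ℤ → G.E => (x j, x (j + 1))) ⁻¹'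
        {e | G.target e.1 = G.source e.2 ∧ y j = G.label e.1} := by
      ext x
      simp [K]
    rw [this]
    refine isClosed_iInter fun j => isClosed_iInter fun _ => isClosed_iInter fun _ => ?_
    exact (isClosed_discrete _).preimage (by fun_prop)
  have hne : ∀ n, (K n).Nonempty := by
    intro n
    -- The constraint at `j = n - 1` involves the edge at `n`, so the window runs from `-n` to `n`
    -- inclusive.
    obtain ⟨p, q, h⟩ := hy (-n) (2 * n + 1)
    obtain ⟨x, hxl, hxs, -⟩ := exists_edges_of_path y _ _ _ _ h
    push_cast at hxl hxs
    exact ⟨x, fun j h₁ h₂ => ⟨hxs j h₁ (by omega), hxl j h₁ (by omega)⟩⟩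
  -- The sets `K n` are nested, nonempty and closed in a product of finite discrete spaces, so they
  -- have a common point.
  obtain ⟨x, hx⟩ := IsCompact.nonempty_iInter_of_sequence_nonempty_isCompact_isClosed K
    (fun n x hx j h₁ h₂ => hx j (by push_cast; omega) (by push_cast; omega)) hne
    (hclosed 0).isCompact hclosed
  rw [Set.mem_iInter] at hx
  have hx' : ∀ j : ℤ, G.target (x j) = G.source (x (j + 1)) ∧ y j = G.label (x j) := fun j =>
    hx (j.natAbs + 1) j (by omega) (by omega)
  exact ⟨x, fun j => (hx' j).1, fun j => (hx' j).2⟩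

theorem shift_eq_of_words_eq {G H : LabeledGraph A} (h : G.words = H.words) :
    G.shift = H.shift := by
  ext y
  exact ⟨fun hy => mem_shift_of_factor_mem_words fun i m => h ▸ factor_mem_words hy i m,
    fun hy => mem_shift_of_factor_mem_words fun i m => h ▸ factor_mem_words hy i m⟩

theorem Essential.exists_ray {G : LabeledGraph A} (hG : G.Essential) {w : List A} :
    ∀ {p q : G.V}, G.Path p w q → ∃ x : ℕ → G.E, G.source (x 0) = p ∧
      (∀ n, G.target (x n) = G.source (x (n + 1))) ∧
      ∀ n (h : n < w.length), G.label (x n) = w[n] := by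
  induction w with
  | nil =>
    intro p q _
    choose out hout using fun v => (hG v).1
    refine ⟨fun n => n.rec (out p) fun _ e => out (G.target e), hout p, fun n => ?_, ?_⟩
    · exact (hout _).symm
    · intro n h
      simp at h
  | cons a w ih =>
    intro p q h
    obtain ⟨e, he, hea, h⟩ := path_cons_iff.1 h
    obtain ⟨x, hx0, hxs, hxl⟩ := ih h
    refine ⟨fun n => n.casesOn e x, he, ?_, ?_⟩
    · rintro (_ | n)
      · exact hx0.symm
      · exact hxs n
    · rintro (_ | n) h
      · exact hea
      · exact hxl n (by simpa using h)

theorem factor_eq {y : ℤ → A} {w : List A} :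
    ∀ {i : ℤ}, (∀ n (h : n < w.length), y (i + n) = w[n]) → factor y i w.length = w := by
  induction w with
  | nil => intro i _; rfl
  | cons a w ih =>
    intro i h
    simp only [List.length_cons, factor, List.cons.injEq]
    refine ⟨by simpa using h 0 (Nat.succ_pos _), ih fun n hn => ?_⟩
    have := h (n + 1) (by simpa using hn)
    rw [List.getElem_cons_succ] at this
    rw [← this]
    congr 1
    push_cast
    ring

/-- In an essential graph every finite path extends to a bi-infinite one. -/
theorem Essential.exists_mem_shift {G : LabeledGraph A} (hG : G.Essential) {w : List A}
    (hw : w ∈ G.words) : ∃ y ∈ G.shift, factor y 0 w.length = w := by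
  obtain ⟨p, q, h⟩ := hw
  obtain ⟨x, hx0, hxs, hxl⟩ := hG.exists_ray h
  choose inn hinn using fun v => (hG v).2
  let l : ℕ → G.E := fun n => n.rec (inn p) fun _ e => inn (G.source e)
  let z : ℤ → G.E := fun i => Int.casesOn i x l
  refine ⟨fun i => G.label (z i), ⟨z, ?_, fun _ => rfl⟩, factor_eq fun n hn => ?_⟩
  · rintro (n | _ | n)
    · exact hxs n
    · exact (hinn p).trans hx0.symm
    · exact hinn _
  · rw [zero_add]
    exact hxl n hn

theorem words_eq_of_shift_eq {G H : LabeledGraph A} (hG : G.Essential) (hH : H.Essential)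
    (h : G.shift = H.shift) : G.words = H.words := by
  ext w
  constructor
  · intro hw
    obtain ⟨y, hy, hyw⟩ := hG.exists_mem_shift hw
    exact hyw ▸ factor_mem_words (h ▸ hy) _ _
  · intro hw
    obtain ⟨y, hy, hyw⟩ := hH.exists_mem_shift hw
    exact hyw ▸ factor_mem_words (h ▸ hy) _ _

/-- After a synchronizing word the current vertex is known, so the words readable from it depend
only on `G.words`, hence can be compared across presentations. -/
theorem SynchronizesTo.append_mem_words_iff {G : LabeledGraph A} {w : List A} {r : G.V}
    (h : G.SynchronizesTo w r) (v : List A) : w ++ v ∈ G.words ↔ ∃ q, G.Path r v q := by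
  constructor
  · rintro ⟨p, q, hpq⟩
    obtain ⟨s, hs, hv⟩ := path_append_iff.1 hpq
    have : s ∈ G.act Set.univ w := ⟨p, trivial, hs⟩
    rw [h] at this
    obtain rfl : s = r := this
    exact ⟨q, hv⟩
  · rintro ⟨q, hq⟩
    have : r ∈ G.act Set.univ w := by
      rw [h]
      rfl
    obtain ⟨p, -, hp⟩ := this
    exact ⟨p, q, path_append_iff.2 ⟨r, hp, hq⟩⟩

theorem exists_min_numVertices {P : LabeledGraph A → Prop} {G : LabeledGraph A} (hG : P G) :
    ∃ H, P H ∧ (∀ K, P K → H.numVertices ≤ K.numVertices) := by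
  obtain ⟨H, hH, hmin⟩ := (measure (numVertices (A := A))).wf.has_min {H | P H} ⟨G, hG⟩
  exact ⟨H, hH, fun K hK => not_lt.1 (hmin K hK)⟩

end LabeledGraph

/-! ### The graph of a multiple-entry automaton -/

namespace MultiEntryDFA

open LabeledGraph

variable {S : Type} {k : ℕ}

/-- The state reached from `q` by reading `u`. -/
def run (N : MultiEntryDFA S k) (q : N.Q) (u : List S) : N.Q := u.foldl N.step q

theorem run_append (N : MultiEntryDFA S k) (q : N.Q) (u v : List S) :
    N.run q (u ++ v) = N.run (N.run q u) v := List.foldl_append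

theorem mem_language_iff (N : MultiEntryDFA S k) {w : List S} :
    w ∈ N.language ↔ ∃ i, N.run (N.entry i) w ∈ N.accept := Iff.rfl

theorem toGraph_essential [Finite S] [Nonempty S] (N : MultiEntryDFA S k)
    (hN : ∀ q, ∃ p a, N.step p a = q) : N.toGraph.Essential := by
  rintro (q | i | _)
  · obtain ⟨p, a, rfl⟩ := hN q
    exact ⟨⟨.trans _ (Classical.arbitrary S), rfl⟩, ⟨.trans p a, rfl⟩⟩
  · exact ⟨⟨.preLoop i, rfl⟩, ⟨.preLoop i, rfl⟩⟩
  · exact ⟨⟨.termLoop, rfl⟩, ⟨.termLoop, rfl⟩⟩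

theorem toGraph_deterministic [Finite S] (N : MultiEntryDFA S k) : N.toGraph.Deterministic := by
  rintro (⟨q, a⟩ | i | i | ⟨q, hq⟩ | _) (⟨q', a'⟩ | i' | i' | ⟨q', hq'⟩ | _) h₁ h₂ <;>
    simp_all [toGraph]

theorem toGraph_numVertices [Finite S] (N : MultiEntryDFA S k) :
    N.toGraph.numVertices = Nat.card N.Q + k + 1 := by
  have := N.finite_Q
  have e : N.toGraph.V ≃ (N.Q ⊕ Fin k) ⊕ Unit :=
    { toFun := fun
        | .state q => .inl (.inl q)
        | .pre i => .inl (.inr i)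
        | .term => .inr ()
      invFun := fun
        | .inl (.inl q) => .state q
        | .inl (.inr i) => .pre i
        | .inr _ => .term
      left_inv := by rintro (_ | _ | _) <;> rfl
      right_inv := by rintro ((_ | _) | _) <;> rfl }
  rw [numVertices, Nat.card_congr e, Nat.card_sum, Nat.card_sum]
  simp

theorem path_letters [Finite S] (N : MultiEntryDFA S k) (q : N.Q) (u : List S) :
    N.toGraph.Path (.state q) (u.map .letter) (.state (N.run q u)) := by
  induction u generalizing q with
  | nil => exact .nil _
  | cons a u ih => exact .cons (G := N.toGraph) (.trans q a) (ih (N.step q a))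

theorem exists_path_rightMark_iff [Finite S] (N : MultiEntryDFA S k) (q : N.Q) (u : List S) :
    (∃ r, N.toGraph.Path (.state q) (u.map .letter ++ [.rightMark]) r) ↔
      N.run q u ∈ N.accept := by
  constructor
  · rintro ⟨r, h⟩
    obtain ⟨s, hs, h⟩ := path_append_iff.1 h
    obtain rfl := N.toGraph_deterministic.path_unique hs (N.path_letters q u)
    obtain ⟨e, he, hea, -⟩ := path_cons_iff.1 h
    rcases e with _ | _ | _ | ⟨p, hp⟩ | _ <;> cases hea
    cases he
    exact hp
  · intro h
    exact ⟨.term, path_append_iff.2 ⟨_, N.path_letters q u,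
      .cons (G := N.toGraph) (.exit ⟨_, h⟩) (.nil _)⟩⟩

theorem path_leftMark [Finite S] (N : MultiEntryDFA S k) {w v : List (Symb S)}
    {x z : N.toGraph.V} (h : N.toGraph.Path x (w ++ .leftMark :: v) z) :
    (∀ s ∈ w, s = .preLoop) ∧ ∃ i, x = .pre i ∧ N.toGraph.Path (.state (N.entry i)) v z := by
  induction w generalizing x with
  | nil =>
    obtain ⟨e, he, hea, h⟩ := path_cons_iff.1 h
    rcases e with _ | _ | i | _ | _ <;> cases hea
    exact ⟨by simp, i, he.symm, h⟩
  | cons a w ih =>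
    obtain ⟨e, he, hea, h⟩ := path_cons_iff.1 h
    obtain ⟨hw, i, hi, hv⟩ := ih h
    rcases e with _ | j | _ | _ | _ <;> cases hi
    exact ⟨List.forall_mem_cons.2 ⟨hea.symm, hw⟩, i, he.symm, hv⟩

/-- Only pre-initial vertices emit `leftMark`, and their only incoming edges are their own loops;
any entry may be the one chosen. -/
theorem leftMark_mem_words_iff [Finite S] (N : MultiEntryDFA S k) {w v : List (Symb S)} :
    w ++ .leftMark :: v ∈ N.toGraph.words ↔
      (∀ s ∈ w, s = .preLoop) ∧ ∃ i z, N.toGraph.Path (.state (N.entry i)) v z := by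
  constructor
  · rintro ⟨x, z, h⟩
    obtain ⟨hw, i, -, h⟩ := N.path_leftMark h
    exact ⟨hw, i, z, h⟩
  · rintro ⟨hw, i, z, h⟩
    refine ⟨.pre i, z, ?_⟩
    induction w with
    | nil => exact .cons (G := N.toGraph) (.enter i) h
    | cons a w ih =>
      obtain ⟨rfl, hw'⟩ := List.forall_mem_cons.1 hw
      exact .cons (G := N.toGraph) (.preLoop i) (ih hw')

/-- A one-entry automaton all of whose states are reachable gives a synchronizing graph. -/
theorem toGraph_synchronizing [Finite S] (N : MultiEntryDFA S 1)
    (hN : ∀ q, ∃ u, N.run (N.entry 0) u = q) : N.toGraph.Synchronizing := by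
  rintro (q | i | _)
  · obtain ⟨u, rfl⟩ := hN q
    refine ⟨.leftMark :: u.map .letter, Set.eq_singleton_iff_unique_mem.2 ⟨?_, ?_⟩⟩
    · exact ⟨.pre 0, trivial, .cons (G := N.toGraph) (.enter 0) (N.path_letters _ u)⟩
    · rintro r ⟨p, -, hp⟩
      obtain ⟨-, i, -, h⟩ := N.path_leftMark (w := []) hp
      obtain rfl := Subsingleton.elim i 0
      exact N.toGraph_deterministic.path_unique h (N.path_letters _ u)
  · refine ⟨[.preLoop], Set.eq_singleton_iff_unique_mem.2 ⟨?_, ?_⟩⟩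
    · exact ⟨.pre i, trivial, .cons (G := N.toGraph) (.preLoop i) (.nil _)⟩
    · rintro r ⟨p, -, hp⟩
      obtain ⟨e, -, hea, h⟩ := path_cons_iff.1 hp
      rcases e with _ | j | _ | _ | _ <;> cases hea
      obtain rfl := Subsingleton.elim j i
      exact (path_nil_iff.1 h).symm
  · refine ⟨[.termLoop], Set.eq_singleton_iff_unique_mem.2 ⟨?_, ?_⟩⟩
    · exact ⟨.term, trivial, .cons (G := N.toGraph) .termLoop (.nil _)⟩
    · rintro r ⟨p, -, hp⟩
      obtain ⟨e, -, hea, h⟩ := path_cons_iff.1 hp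
      rcases e with _ | _ | _ | _ | _ <;> cases hea
      exact (path_nil_iff.1 h).symm

/-! ### The subset automaton presents the same shift -/

/-- The subset automaton on nonempty sets of states, started in the set of all states. -/
def subsets (N : MultiEntryDFA S k) [Nonempty N.Q] : MultiEntryDFA S 1 where
  Q := {T : Set N.Q // T.Nonempty}
  finite_Q := by
    have := N.finite_Q
    infer_instance
  step T a := ⟨(N.step · a) '' T.1, T.2.image _⟩
  entry _ := ⟨Set.univ, Set.univ_nonempty⟩
  entry_injective := Function.injective_of_subsingleton _
  accept := {T | ∃ q ∈ T.1, q ∈ N.accept}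

theorem subsets_run (N : MultiEntryDFA S k) [Nonempty N.Q] (T : N.subsets.Q) (u : List S) :
    (N.subsets.run T u).1 = (N.run · u) '' T.1 := by
  induction u generalizing T with
  | nil => exact (Set.image_id' _).symm
  | cons a u ih =>
    refine (ih _).trans ?_
    change (N.run · u) '' ((N.step · a) '' T.1) = _
    rw [Set.image_image]
    rfl

/-- A vertex of the graph of the subset automaton dominates the vertices it stands for. -/
def Dominates (N : MultiEntryDFA S k) [Nonempty N.Q] : N.subsets.Vertex → N.Vertex → Prop
  | .state T, .state q => q ∈ T.1
  | .pre _, .pre _ => True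
  | .term, .term => True
  | _, _ => False

/-- Domination is preserved along edges, so paths lift forwards; the next lemma pulls paths back
from their end vertex. -/
theorem Dominates.exists_path [Finite S] {N : MultiEntryDFA S k} [Nonempty N.Q]
    {x z : N.toGraph.V} {y : N.subsets.toGraph.V} {w : List (Symb S)} (hxy : N.Dominates y x)
    (h : N.toGraph.Path x w z) : ∃ r, N.subsets.toGraph.Path y w r := by
  induction h generalizing y with
  | nil => exact ⟨y, .nil _⟩
  | cons e _ ih =>
    rcases e with ⟨q, a⟩ | i | i | ⟨q, hq⟩ | _ <;> rcases y with T | j | _ <;>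
      first | exact hxy.elim | skip
    · obtain ⟨r, hr⟩ := ih (y := .state (N.subsets.step T a)) ⟨q, hxy, rfl⟩
      exact ⟨r, .cons (G := N.subsets.toGraph) (.trans T a) hr⟩
    · obtain ⟨r, hr⟩ := ih (y := .pre j) trivial
      exact ⟨r, .cons (G := N.subsets.toGraph) (.preLoop j) hr⟩
    · obtain ⟨r, hr⟩ := ih (y := .state (N.subsets.entry j)) trivial
      exact ⟨r, .cons (G := N.subsets.toGraph) (.enter j) hr⟩
    · obtain ⟨r, hr⟩ := ih (y := .term) trivial
      exact ⟨r, .cons (G := N.subsets.toGraph) (.exit ⟨T, q, hxy, hq⟩) hr⟩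
    · obtain ⟨r, hr⟩ := ih (y := .term) trivial
      exact ⟨r, .cons (G := N.subsets.toGraph) .termLoop hr⟩

theorem exists_path_of_subsets_path [Finite S] {N : MultiEntryDFA S k} [Nonempty N.Q]
    (hN : Function.Surjective N.entry) {y r : N.subsets.toGraph.V} {w : List (Symb S)}
    (h : N.subsets.toGraph.Path y w r) {z : N.toGraph.V} (hz : N.Dominates r z) :
    ∃ x : N.toGraph.V, N.Dominates y x ∧ N.toGraph.Path x w z := by
  induction h with
  | nil => exact ⟨z, hz, .nil _⟩
  | cons e _ ih =>
    obtain ⟨x, hx, hp⟩ := ih hz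
    rcases e with ⟨T, a⟩ | i | i | ⟨T, q, hqT, hq⟩ | _ <;> rcases x with p | j | _ <;>
      first | exact hx.elim | skip
    · obtain ⟨q, hq, rfl⟩ := hx
      exact ⟨.state q, hq, .cons (G := N.toGraph) (.trans q a) hp⟩
    · exact ⟨.pre j, trivial, .cons (G := N.toGraph) (.preLoop j) hp⟩
    -- The entry of the subset automaton is the set of all states, so `p` is arbitrary here and must
    -- itself be an entry.
    · obtain ⟨j, rfl⟩ := hN p
      exact ⟨.pre j, trivial, .cons (G := N.toGraph) (.enter j) hp⟩
    · exact ⟨.state q, hqT, .cons (G := N.toGraph) (.exit ⟨q, hq⟩) hp⟩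
    · exact ⟨.term, trivial, .cons (G := N.toGraph) .termLoop hp⟩

theorem subsets_words [Finite S] (N : MultiEntryDFA S k) [Nonempty N.Q]
    (hN : Function.Surjective N.entry) : N.subsets.toGraph.words = N.toGraph.words := by
  ext w
  constructor
  · rintro ⟨y, r, h⟩
    have : ∃ z, N.Dominates r z := by
      rcases r with T | _ | _
      · exact ⟨.state T.2.some, T.2.some_mem⟩
      · exact ⟨.pre (hN (Classical.arbitrary N.Q)).choose, trivial⟩
      · exact ⟨.term, trivial⟩
    obtain ⟨z, hz⟩ := this
    obtain ⟨x, -, hx⟩ := exists_path_of_subsets_path hN h hz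
    exact ⟨x, z, hx⟩
  · rintro ⟨x, z, h⟩
    have : ∃ y, N.Dominates y x := by
      rcases x with q | _ | _
      · exact ⟨.state ⟨{q}, q, rfl⟩, rfl⟩
      · exact ⟨.pre 0, trivial⟩
      · exact ⟨.term, trivial⟩
    obtain ⟨y, hy⟩ := this
    exact ⟨y, hy.exists_path h⟩

/-! ### Extremal automata and the lower bounds -/

/-- All states are initial, every nonempty set of states is the image of the set of all states
under some word, some letter permutes the states, and every state is the only one that accepts
some word. -/
structure Extremal (N : MultiEntryDFA S k) : Prop where
  entry_surjective : Function.Surjective N.entry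
  exists_range_run : ∀ T : Set N.Q, T.Nonempty → ∃ u, Set.range (N.run · u) = T
  exists_surjective_step : ∃ a, Function.Surjective (N.step · a)
  exists_separating : ∀ q, ∃ z, ∀ p, N.run p z ∈ N.accept ↔ p = q

namespace Extremal

variable {N : MultiEntryDFA S k}

theorem subsets_reachable [Nonempty N.Q] (hN : N.Extremal) (T : N.subsets.Q) :
    ∃ u, N.subsets.run (N.subsets.entry 0) u = T := by
  obtain ⟨u, hu⟩ := hN.exists_range_run T.1 T.2
  refine ⟨u, Subtype.ext ?_⟩
  rw [subsets_run, ← hu]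
  exact Set.image_univ

theorem toGraph_essential [Finite S] (hN : N.Extremal) : N.toGraph.Essential := by
  obtain ⟨a, ha⟩ := hN.exists_surjective_step
  have : Nonempty S := ⟨a⟩
  exact N.toGraph_essential fun q => (ha q).imp fun p hp => ⟨a, hp⟩

theorem subsets_toGraph_essential [Finite S] [Nonempty N.Q] (hN : N.Extremal) :
    N.subsets.toGraph.Essential := by
  obtain ⟨a, ha⟩ := hN.exists_surjective_step
  have : Nonempty S := ⟨a⟩
  refine N.subsets.toGraph_essential fun T => ?_
  -- Surjectivity of `a` makes the preimage of `T` nonempty and its image all of `T`.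
  refine ⟨⟨(N.step · a) ⁻¹' T.1, T.2.preimage ha⟩, a, Subtype.ext ?_⟩
  exact Set.image_preimage_eq _ ha

theorem subsets_isSDP [Finite S] [Nonempty N.Q] (hN : N.Extremal) :
    N.subsets.toGraph.IsSDP N.toGraph.shift :=
  ⟨⟨hN.subsets_toGraph_essential, N.subsets.toGraph_deterministic,
    shift_eq_of_words_eq (N.subsets_words hN.entry_surjective)⟩,
    N.subsets.toGraph_synchronizing hN.subsets_reachable⟩

theorem append_mem_language_iff (hN : N.Extremal) (u z : List S) :
    u ++ z ∈ N.language ↔ ∃ q ∈ Set.range (N.run · u), N.run q z ∈ N.accept := by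
  rw [mem_language_iff, Set.exists_range_iff, ← hN.entry_surjective.exists
    (p := fun q => N.run q (u ++ z) ∈ N.accept)]
  simp only [run_append]

theorem card_nonempty_sets (Q : Type) [Finite Q] :
    Nat.card {T : Set Q // T.Nonempty} = 2 ^ Nat.card Q - 1 := by
  classical
  have := Fintype.ofFinite Q
  have h : {T : Set Q // T.Nonempty} ≃ {T : Set Q // T ≠ ∅} :=
    Equiv.subtypeEquivRight fun _ => Set.nonempty_iff_ne_empty
  rw [Nat.card_congr h, Nat.card_eq_fintype_card, Fintype.card_subtype_compl,
    Fintype.card_subtype_eq, Fintype.card_set, Nat.card_eq_fintype_card]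

/-- Anything that tells the residuals of the language apart has at least `2 ^ |Q| - 1` elements. -/
theorem le_card (hN : N.Extremal) {α : Type} [Finite α] (P : α → List S → Prop)
    (h : ∀ u, ∃ r, ∀ z, u ++ z ∈ N.language ↔ P r z) : 2 ^ Nat.card N.Q - 1 ≤ Nat.card α := by
  have := N.finite_Q
  choose f hf using h
  choose u hu using fun T : {T : Set N.Q // T.Nonempty} => hN.exists_range_run T.1 T.2
  rw [← card_nonempty_sets]
  refine Nat.card_le_card_of_injective (fun T => f (u T)) fun T T' hTT' => Subtype.ext ?_
  -- A separating word for `q` tests whether `q ∈ T`, so the element assigned to `T` determines `T`.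
  have key : ∀ T q z, (∀ p, N.run p z ∈ N.accept ↔ p = q) → (q ∈ T.1 ↔ P (f (u T)) z) := by
    intro T q z hz
    rw [← hf, hN.append_mem_language_iff, hu]
    simp [hz]
  ext q
  obtain ⟨z, hz⟩ := hN.exists_separating q
  rw [key T q z hz, key T' q z hz]
  exact iff_of_eq (congrArg (P · z) hTT')

theorem minimalDFASize [Nonempty N.Q] (hN : N.Extremal) :
    MinimalDFASize N.language (2 ^ Nat.card N.Q - 1) := by
  have := N.finite_Q
  refine ⟨⟨N.subsets.Q, N.subsets.finite_Q, ⟨N.subsets.step, N.subsets.entry 0, N.subsets.accept⟩,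
    ?_, card_nonempty_sets _⟩, ?_⟩
  · ext w
    change (∃ q ∈ (N.subsets.run (N.subsets.entry 0) w).1, q ∈ N.accept) ↔ _
    rw [subsets_run, mem_language_iff, ← hN.entry_surjective.exists
      (p := fun q => N.run q w ∈ N.accept)]
    simp [subsets]
  · rintro _ ⟨Q, hQ, M, hM, rfl⟩
    refine hN.le_card (fun q z => M.evalFrom q z ∈ M.accept) fun u => ⟨M.eval u, fun z => ?_⟩
    rw [← hM, DFA.mem_accepts, DFA.eval, DFA.evalFrom_of_append]

theorem le_numVertices [Finite S] [Nonempty N.Q] (hN : N.Extremal) {H : LabeledGraph (Symb S)}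
    (hH : H.IsSDP N.toGraph.shift) : 2 ^ Nat.card N.Q - 1 ≤ H.numVertices := by
  obtain ⟨⟨hess, hdet, hshift⟩, hsync⟩ := hH
  have hwords := words_eq_of_shift_eq hess hN.toGraph_essential hshift
  have := H.finite_V
  have hleft : [.leftMark] ∈ H.words := by
    rw [hwords]
    exact (N.leftMark_mem_words_iff (w := []) (v := [])).2
      ⟨by simp, (hN.entry_surjective (Classical.arbitrary _)).choose, _, .nil _⟩
  obtain ⟨p, v, hpv⟩ := hleft
  obtain ⟨w, hw⟩ := hsync p
  -- `leftMark` can follow `w`, which leaves only loops at a pre-initial vertex for `w`.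
  have hstar : ∀ s ∈ w, s = .preLoop := by
    have := (hw.append_mem_words_iff _).2 ⟨v, hpv⟩
    rw [hwords] at this
    exact (N.leftMark_mem_words_iff.1 this).1
  -- By determinism `v` is the only vertex reached from `p` by `leftMark`, so its words are those
  -- readable from some entry.
  have hpath : ∀ x, (∃ r, H.Path v x r) ↔ ∃ i z, N.toGraph.Path (.state (N.entry i)) x z := by
    intro x
    have h₁ := hw.append_mem_words_iff (.leftMark :: x)
    rw [hwords, N.leftMark_mem_words_iff, and_iff_right hstar] at h₁
    rw [h₁]
    refine exists_congr fun r => ?_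
    rw [← List.singleton_append, path_append_iff]
    exact ⟨fun h => ⟨v, hpv, h⟩, fun ⟨v', h, h'⟩ => hdet.path_unique h hpv ▸ h'⟩
  refine hN.le_card (fun r z => ∃ t, H.Path r (z.map .letter ++ [.rightMark]) t) fun u => ?_
  obtain ⟨r, hr⟩ := (hpath (u.map .letter)).2
    ⟨(hN.entry_surjective (Classical.arbitrary _)).choose, _, N.path_letters _ u⟩
  refine ⟨r, fun z => ?_⟩
  have h₂ := hpath ((u ++ z).map .letter ++ [.rightMark])
  simp only [exists_path_rightMark_iff] at h₂
  rw [mem_language_iff, ← h₂, List.map_append, List.append_assoc]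
  refine exists_congr fun t => ?_
  rw [path_append_iff]
  exact ⟨fun ⟨r', h, h'⟩ => hdet.path_unique h hr ▸ h', fun h => ⟨r, hr, h⟩⟩

end Extremal

/-! ### The rotate-and-merge automaton -/

/-- The transition function on `Fin k` in which `true` rotates the states and `false` merges `0`
into its successor. -/
def rotateMergeStep (k : ℕ) (q : Fin k) (a : Bool) : Fin k :=
  if a ∨ q.val = 0 then finRotate k q else q

theorem foldl_replicate_true (k m : ℕ) (q : Fin (k + 1)) :
    (List.replicate m true).foldl (rotateMergeStep (k + 1)) q = q + Fin.ofNat (k + 1) m := by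
  induction m generalizing q with
  | zero => simp
  | succ m ih =>
    have h : rotateMergeStep (k + 1) q true = q + 1 := by simp [rotateMergeStep]
    rw [List.replicate_succ, List.foldl_cons, ih, h]
    apply Fin.ext
    simp [Fin.val_add, add_comm, add_left_comm]

theorem exists_foldl_eq_add (k : ℕ) (c : Fin (k + 1)) :
    ∃ u : List Bool, ∀ q, u.foldl (rotateMergeStep (k + 1)) q = q + c :=
  ⟨List.replicate c true, fun q => by rw [foldl_replicate_true]; simp⟩

/-- Conjugate the merging letter by a rotation: move `x` to `0`, merge, and rotate back. -/
theorem exists_foldl_eq_merge (k : ℕ) (x : Fin (k + 1)) :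
    ∃ u : List Bool, ∀ q,
      u.foldl (rotateMergeStep (k + 1)) q = if q = x then x + 1 else q := by
  obtain ⟨u, hu⟩ := exists_foldl_eq_add k (-x)
  obtain ⟨v, hv⟩ := exists_foldl_eq_add k x
  refine ⟨u ++ false :: v, fun q => ?_⟩
  rw [List.foldl_append, List.foldl_cons, hu, hv]
  by_cases hq : q = x
  · simp [rotateMergeStep, hq, add_comm]
  · have : q + -x ≠ 0 := by
      rw [← sub_eq_add_neg]
      exact sub_ne_zero.2 hq
    simp [rotateMergeStep, hq, this]

/-- Otherwise `T` would be closed under cyclic predecessors, hence everything. -/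
theorem exists_notMem_add_one_mem {k : ℕ} {T : Set (Fin (k + 1))} (hT : T.Nonempty)
    (hT' : T ≠ Set.univ) : ∃ x, x ∉ T ∧ x + 1 ∈ T := by
  by_contra! h
  obtain ⟨s, hs⟩ := hT
  have key : ∀ m : ℕ, s - Fin.ofNat (k + 1) m ∈ T := by
    intro m
    induction m with
    | zero => simpa using hs
    | succ m ih =>
      by_contra hm
      refine h _ hm ?_
      convert ih using 1
      have : Fin.ofNat (k + 1) (m + 1) = Fin.ofNat (k + 1) m + 1 := by
        apply Fin.ext
        simp [Fin.val_add]
      rw [this]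
      abel
  refine hT' (Set.eq_univ_of_forall fun q => ?_)
  have := key (s - q).val
  simpa using this

/-- Induction on the size of the complement: `T` is the image of the larger set `insert x T` when `x
∉ T` is merged into `x + 1 ∈ T`. -/
theorem exists_range_foldl_eq (k : ℕ) (T : Set (Fin (k + 1))) (hT : T.Nonempty) :
    ∃ u : List Bool, Set.range (fun q => u.foldl (rotateMergeStep (k + 1)) q) = T := by
  induction hn : Tᶜ.ncard using Nat.strong_induction_on generalizing T with
  | _ n ih =>
  by_cases hT' : T = Set.univ
  · exact ⟨[], hT' ▸ Set.range_id⟩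
  obtain ⟨x, hx, hx'⟩ := exists_notMem_add_one_mem hT hT'
  have hlt : (insert x T)ᶜ.ncard < n := by
    rw [← hn]
    exact Set.ncard_lt_ncard (compl_lt_compl_iff_lt.2 (Set.ssubset_insert hx)) (Set.toFinite _)
  obtain ⟨u, hu⟩ := ih _ hlt _ (Set.insert_nonempty x T) rfl
  obtain ⟨v, hv⟩ := exists_foldl_eq_merge k x
  refine ⟨u ++ v, ?_⟩
  simp only [List.foldl_append, hv]
  refine (Set.range_comp (fun p => if p = x then x + 1 else p) _).trans ?_
  rw [hu, Set.image_insert_eq, if_pos rfl]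
  have : (fun p => if p = x then x + 1 else p) '' T = T := by
    refine (Set.image_congr fun p hp => ?_).trans (Set.image_id' T)
    exact if_neg (ne_of_mem_of_not_mem hp hx)
  rw [this, Set.insert_eq_of_mem hx']

theorem exists_foldl_val_eq_zero_iff (k : ℕ) (q : Fin (k + 1)) :
    ∃ u : List Bool, ∀ p, (u.foldl (rotateMergeStep (k + 1)) p).val = 0 ↔ p = q := by
  obtain ⟨u, hu⟩ := exists_foldl_eq_add k (-q)
  refine ⟨u, fun p => ?_⟩
  rw [hu, Fin.val_eq_zero_iff]
  exact add_neg_eq_zero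

theorem rotateMergeStep_true_surjective (k : ℕ) :
    Function.Surjective (rotateMergeStep k · true) := by
  have : (rotateMergeStep k · true) = finRotate k := by
    ext q
    simp [rotateMergeStep]
  rw [this]
  exact (finRotate k).surjective

/-- The automaton with transition function `rotateMergeStep` in which all states are initial and
`0` is the accepting state. -/
def rotateMerge (k : ℕ) : MultiEntryDFA Bool k where
  Q := Fin k
  finite_Q := inferInstance
  step := rotateMergeStep k
  entry := id
  entry_injective := Function.injective_id
  accept := {q | q.val = 0}

theorem rotateMerge_extremal (k : ℕ) : (rotateMerge (k + 1)).Extremal where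
  entry_surjective := Function.surjective_id
  exists_range_run := exists_range_foldl_eq k
  exists_surjective_step := ⟨true, rotateMergeStep_true_surjective (k + 1)⟩
  exists_separating := exists_foldl_val_eq_zero_iff k

end MultiEntryDFA

/-! ### Assembly and constants -/

open MultiEntryDFA LabeledGraph in
theorem mainTheorem7 :
    ∃ (S : Type) (_ : Finite S) (C : (k : ℕ) → MultiEntryDFA S k) (X : ℕ → Set (ℤ → Symb S)),
      (∀ k, Nat.card (C k).Q = k) ∧
      (∀ k, 1 ≤ k → MinimalDFASize (C k).language (2 ^ k - 1)) ∧
      (∀ n, IsSofic (X n)) ∧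
      ∃ c : ℝ, 0 < c ∧ ∃ n₀ : ℕ, ∀ n, n₀ ≤ n →
        ((C ((n - 1) / 2)).toGraph.IsDetPresentation (X n) ∧
          (C ((n - 1) / 2)).toGraph.numVertices ≤ n) ∧
        (∃ G : LabeledGraph (Symb S), G.IsMinimalDetPresentation (X n) ∧ G.numVertices ≤ n) ∧
        (∃ H : LabeledGraph (Symb S), H.IsMinimalSDP (X n) ∧
          (2 : ℝ) ^ (c * (n : ℝ)) ≤ (H.numVertices : ℝ)) := by
  have hcard : ∀ k, Nat.card (rotateMerge k).Q = k := fun k => Nat.card_fin k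
  have hne : ∀ k, Nonempty (rotateMerge (k + 1)).Q := fun k => ⟨(0 : Fin (k + 1))⟩
  -- With `(n - 1) / 2 = k + 1` and `n ≥ 8` one has `n ≤ 4 * k`; as `2 ^ (k + 1) - 1 ≥ 2 ^ k`, the
  -- constant `1 / 4` suffices.
  refine ⟨Bool, inferInstance, rotateMerge, fun n => (rotateMerge ((n - 1) / 2)).toGraph.shift,
    hcard, ?_, fun n => ⟨_, rfl⟩, 1 / 4, by norm_num, 8, fun n hn => ?_⟩
  · rintro (_ | k) hk
    · omega
    · have := hne k
      simpa only [hcard] using (rotateMerge_extremal k).minimalDFASize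
  dsimp only
  generalize hm : (n - 1) / 2 = m
  obtain ⟨k, rfl⟩ : ∃ k, m = k + 1 := ⟨m - 1, by omega⟩
  have := hne k
  have hext := rotateMerge_extremal k
  have hpres : (rotateMerge (k + 1)).toGraph.IsDetPresentation (rotateMerge (k + 1)).toGraph.shift :=
    ⟨hext.toGraph_essential, toGraph_deterministic _, rfl⟩
  have hsize : (rotateMerge (k + 1)).toGraph.numVertices ≤ n := by
    rw [toGraph_numVertices, hcard]
    omega
  refine ⟨⟨hpres, hsize⟩, ?_, ?_⟩
  · obtain ⟨G, hG, hmin⟩ := exists_min_numVertices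
      (P := (IsDetPresentation · (rotateMerge (k + 1)).toGraph.shift)) hpres
    exact ⟨G, ⟨hG, hmin⟩, (hmin _ hpres).trans hsize⟩
  · obtain ⟨H, hH, hmin⟩ := exists_min_numVertices
      (P := (IsSDP · (rotateMerge (k + 1)).toGraph.shift)) hext.subsets_isSDP
    refine ⟨H, ⟨hH, hmin⟩, ?_⟩
    have hle : 2 ^ k ≤ H.numVertices := by
      have h₁ := hext.le_numVertices hH
      rw [hcard, pow_succ] at h₁
      have h₂ := Nat.one_le_two_pow (n := k)
      omega
    calc (2 : ℝ) ^ (1 / 4 * (n : ℝ)) ≤ (2 : ℝ) ^ (k : ℝ) := by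
          refine Real.rpow_le_rpow_of_exponent_le one_le_two ?_
          have : (n : ℝ) ≤ 4 * k := by exact_mod_cast (by omega : n ≤ 4 * k)
          linarith
      _ = ((2 ^ k : ℕ) : ℝ) := by
          rw [Real.rpow_natCast]
          push_cast
          rfl
      _ ≤ H.numVertices := by exact_mod_cast hle
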